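/- Let $\mathrm{Gp}_\omega$ be the set of all groups with domain $\omega=\mathbb{N}$, each group being identified with its multiplication $\mathbb{N}\times\mathbb{N}\to\mathbb{N}$, and equipped with the Borel structure inherited from $\mathbb{N}^{\mathbb{N}\times\mathbb{N}}$. Let $\mathrm{NiGp}(2)_\omega\subseteq\mathrm{Gp}_\omega$ be the (standard) Borel space of those groups with domain $\omega$ that are nilpotent of class $2$. A group $G$ is called co-Hopfian if every injective endomorphism of $G$ is surjective. Theorem 1.5. The set of co-Hopfian groups is complete co-analytic in $\mathrm{NiGp}(2)_\omega$. That is, the set $\mathrm{CoHopf}=\{G\in\mathrm{NiGp}(2)_\omega : G\text{ is co-Hopfian}\}$ is a co-analytic subset of $\mathrm{NiGp}(2)_\omega$ (its complement is analytic), and for every standard Borel space $Y$ and every co-analytic subset $B\subseteq Y$ there is a Borel map $f\colon Y\to\mathrm{NiGp}(2)_\omega$ such that $B=f^{-1}(\mathrm{CoHopf})$. -/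

import Mathlib

universe u v

/-! ### Analytic, co-analytic and complete co-analytic subsets of standard Borel spaces -/

/-- A subset of a standard Borel space `X` is analytic if it is the projection to `X` of a Borel
subset of `X × ℕ^ℕ`. -/
def IsAnalyticIn {X : Type u} [MeasurableSpace X] [StandardBorelSpace X] (A : Set X) : Prop :=
  ∃ B : Set (X × (ℕ → ℕ)), MeasurableSet B ∧ A = Prod.fst '' B

/-- A subset of a standard Borel space is co-analytic if its complement is analytic. -/
def IsCoanalyticIn {X : Type u} [MeasurableSpace X] [StandardBorelSpace X] (A : Set X) : Prop :=
  IsAnalyticIn Aᶜ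

/-- A subset `A` of a standard Borel space `X` is complete co-analytic if it is co-analytic and
every co-analytic subset `B` of every standard Borel space `Y` is the preimage of `A` under
some Borel map `Y → X`. -/
def IsCompleteCoanalyticIn {X : Type u} [MeasurableSpace X] [StandardBorelSpace X]
    (A : Set X) : Prop :=
  IsCoanalyticIn A ∧
    ∀ (Y : Type v) [MeasurableSpace Y] [StandardBorelSpace Y] (B : Set Y), IsCoanalyticIn B →
      ∃ f : Y → X, Measurable f ∧ B = f ⁻¹' A

/-- In a Polish space, the notion of analytic set above is Mathlib's. -/
theorem isAnalyticIn_iff_analyticSet {X : Type u} [TopologicalSpace X] [PolishSpace X]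
    [MeasurableSpace X] [BorelSpace X] (A : Set X) :
    IsAnalyticIn A ↔ MeasureTheory.AnalyticSet A := by
  constructor
  · rintro ⟨B, hB, rfl⟩
    exact hB.analyticSet_image measurable_fst
  · intro h
    rw [MeasureTheory.AnalyticSet] at h
    rcases h with rfl | ⟨f, hf, rfl⟩
    · exact ⟨∅, MeasurableSet.empty, by simp⟩
    · refine ⟨{q | q.1 = f q.2},
        measurableSet_eq_fun measurable_fst (hf.measurable.comp measurable_snd), ?_⟩
      ext x
      constructor
      · rintro ⟨y, rfl⟩
        exact ⟨(f y, y), rfl, rfl⟩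
      · rintro ⟨⟨x', y⟩, h, rfl⟩
        exact ⟨y, h.symm⟩

/-! ### The Borel space of groups with domain `ℕ` -/

/-- `m` is the multiplication of a group with domain `ℕ`. -/
structure IsGroupTable (m : ℕ → ℕ → ℕ) : Prop where
  assoc : ∀ a b c, m (m a b) c = m a (m b c)
  exists_one_inv : ∃ e, (∀ a, m e a = a) ∧ ∀ a, ∃ b, m b a = e

/-- The space of groups with domain `ℕ`, a group being given by its multiplication. It carries the
Borel structure inherited from `ℕ → ℕ → ℕ`. -/
def GpOmega : Type := {m : ℕ → ℕ → ℕ // IsGroupTable m}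

namespace GpOmega

theorem measurableSet_forall {X ι : Type*} [MeasurableSpace X] [Countable ι] {p : ι → X → Prop}
    (h : ∀ i, MeasurableSet {x | p i x}) : MeasurableSet {x | ∀ i, p i x} := by
  rw [Set.ofPred_forall]
  exact MeasurableSet.iInter h

theorem measurableSet_exists {X ι : Type*} [MeasurableSpace X] [Countable ι] {p : ι → X → Prop}
    (h : ∀ i, MeasurableSet {x | p i x}) : MeasurableSet {x | ∃ i, p i x} := by
  rw [Set.ofPred_exists]
  exact MeasurableSet.iUnion h

instance : MeasurableSpace GpOmega :=
  inferInstanceAs (MeasurableSpace {m : ℕ → ℕ → ℕ // IsGroupTable m})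

/-- The domain of a member of `GpOmega`, that is `ℕ`; the group structure is put on this copy
of `ℕ`. -/
def Carrier (_G : GpOmega) : Type := ℕ

noncomputable instance (G : GpOmega) : Group G.Carrier :=
  letI : Mul G.Carrier := ⟨G.1⟩
  letI : One G.Carrier := ⟨G.2.exists_one_inv.choose⟩
  letI : Inv G.Carrier := ⟨fun a => (G.2.exists_one_inv.choose_spec.2 a).choose⟩
  Group.ofLeftAxioms G.2.assoc G.2.exists_one_inv.choose_spec.1
    fun a => (G.2.exists_one_inv.choose_spec.2 a).choose_spec

/-- The natural number `n` as an element of the group `G`. -/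
def elt (G : GpOmega) (n : ℕ) : G.Carrier := n

/-- An element of the group `G` as a natural number. -/
def code {G : GpOmega} (a : G.Carrier) : ℕ := a

theorem measurableSet_isGroupTable : MeasurableSet {m : ℕ → ℕ → ℕ | IsGroupTable m} := by
  have hm : ∀ f g : (ℕ → ℕ → ℕ) → ℕ, Measurable f → Measurable g →
      Measurable fun m : ℕ → ℕ → ℕ => m (f m) (g m) := by
    intro f g hf hg
    have h : Measurable fun q : (ℕ → ℕ → ℕ) × ℕ × ℕ => q.1 q.2.1 q.2.2 :=
      measurable_from_prod_countable_left fun y =>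
        (measurable_pi_apply y.2).comp (measurable_pi_apply y.1)
    exact h.comp (measurable_id.prodMk (hf.prodMk hg))
  have hc : ∀ a : ℕ, Measurable fun _ : ℕ → ℕ → ℕ => a := fun a => measurable_const
  have : {m : ℕ → ℕ → ℕ | IsGroupTable m} =
      {m | (∀ a b c, m (m a b) c = m a (m b c)) ∧
        ∃ e, (∀ a, m e a = a) ∧ ∀ a, ∃ b, m b a = e} := by
    ext m
    exact ⟨fun h => ⟨h.1, h.2⟩, fun h => ⟨h.1, h.2⟩⟩
  rw [this]
  refine MeasurableSet.inter (measurableSet_forall fun a => measurableSet_forall fun b =>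
    measurableSet_forall fun c => measurableSet_eq_fun (hm _ _ (hm _ _ (hc a) (hc b)) (hc c))
      (hm _ _ (hc a) (hm _ _ (hc b) (hc c)))) ?_
  exact measurableSet_exists fun e => MeasurableSet.inter
    (measurableSet_forall fun a => measurableSet_eq_fun (hm _ _ (hc e) (hc a)) (hc a))
    (measurableSet_forall fun a => measurableSet_exists fun b =>
      measurableSet_eq_fun (hm _ _ (hc b) (hc a)) (hc e))

instance : StandardBorelSpace GpOmega := measurableSet_isGroupTable.standardBorel

/-- Multiplication depends on the group in a Borel way. -/
theorem measurable_mul {f g : GpOmega → ℕ} (hf : Measurable f) (hg : Measurable g) :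
    Measurable fun G : GpOmega => G.1 (f G) (g G) := by
  have h : Measurable fun q : GpOmega × ℕ × ℕ => q.1.1 q.2.1 q.2.2 :=
    measurable_from_prod_countable_left fun y =>
      (measurable_pi_apply y.2).comp ((measurable_pi_apply y.1).comp measurable_subtype_coe)
  exact h.comp (measurable_id.prodMk (hf.prodMk hg))

/-- Inversion depends on the group in a Borel way. -/
theorem measurable_inv {f : GpOmega → ℕ} (hf : Measurable f) :
    Measurable fun G : GpOmega => code (G.elt (f G))⁻¹ := by
  refine measurable_to_countable' fun k => ?_
  have : (fun G : GpOmega => code (G.elt (f G))⁻¹) ⁻¹' {k} =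
      {G : GpOmega | G.1 (G.1 k (f G)) k = k} := by
    ext G
    change (G.elt (f G))⁻¹ = G.elt k ↔ G.elt k * G.elt (f G) * G.elt k = G.elt k
    rw [mul_eq_right, inv_eq_iff_mul_eq_one, mul_eq_one_comm]
  rw [this]
  exact measurableSet_eq_fun
    (measurable_mul (measurable_mul measurable_const hf) measurable_const) measurable_const

theorem measurableSet_mem_upperCentralSeries (n : ℕ) {f : GpOmega → ℕ} (hf : Measurable f) :
    MeasurableSet {G : GpOmega |
      G.elt (f G) ∈ Subgroup.upperCentralSeries G.Carrier n} := by
  induction n generalizing f with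
  | zero =>
    have : {G : GpOmega | G.elt (f G) ∈ Subgroup.upperCentralSeries G.Carrier 0} =
        {G : GpOmega | G.1 (f G) (f G) = f G} := by
      ext G
      change G.elt (f G) ∈ (⊥ : Subgroup G.Carrier) ↔ G.elt (f G) * G.elt (f G) = G.elt (f G)
      rw [Subgroup.mem_bot, mul_eq_right]
    rw [this]
    exact measurableSet_eq_fun (measurable_mul hf hf) hf
  | succ n ih =>
    have : {G : GpOmega |
          G.elt (f G) ∈ Subgroup.upperCentralSeries G.Carrier (n + 1)} =
        {G : GpOmega | ∀ y : ℕ, G.elt (f G) * G.elt y * (G.elt (f G))⁻¹ * (G.elt y)⁻¹ ∈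
          Subgroup.upperCentralSeries G.Carrier n} := by
      ext G
      exact Subgroup.mem_upperCentralSeries_succ_iff
    rw [this]
    refine measurableSet_forall fun y => ih ?_
    exact measurable_mul (measurable_mul (measurable_mul hf measurable_const) (measurable_inv hf))
      (measurable_inv measurable_const)

theorem measurableSet_upperCentralSeries_eq_top (n : ℕ) :
    MeasurableSet {G : GpOmega | Subgroup.upperCentralSeries G.Carrier n = ⊤} := by
  have : {G : GpOmega | Subgroup.upperCentralSeries G.Carrier n = ⊤} =
      {G : GpOmega | ∀ x : ℕ,
        G.elt x ∈ Subgroup.upperCentralSeries G.Carrier n} := by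
    ext G
    exact Subgroup.eq_top_iff' _
  rw [this]
  exact measurableSet_forall fun x => measurableSet_mem_upperCentralSeries n measurable_const

theorem measurableSet_nilpotencyClass_eq (n : ℕ) :
    MeasurableSet {G : GpOmega |
      Group.IsNilpotent G.Carrier ∧ Group.nilpotencyClass G.Carrier = n} := by
  have : {G : GpOmega | Group.IsNilpotent G.Carrier ∧ Group.nilpotencyClass G.Carrier = n} =
      {G : GpOmega | Subgroup.upperCentralSeries G.Carrier n = ⊤ ∧
        ∀ k : Fin n, ¬ Subgroup.upperCentralSeries G.Carrier k = ⊤} := by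
    ext G
    constructor
    · rintro ⟨h, hn⟩
      refine ⟨Subgroup.upperCentralSeries_eq_top_iff_nilpotencyClass_le.2 hn.le, fun k hk => ?_⟩
      have := Subgroup.upperCentralSeries_eq_top_iff_nilpotencyClass_le.1 hk
      have := k.2
      omega
    · rintro ⟨h, hn⟩
      have hnil : Group.IsNilpotent G.Carrier := ⟨n, h⟩
      refine ⟨hnil, le_antisymm
        (Subgroup.upperCentralSeries_eq_top_iff_nilpotencyClass_le.1 h) ?_⟩
      by_contra! hlt
      exact hn ⟨_, hlt⟩ (Subgroup.upperCentralSeries_eq_top_iff_nilpotencyClass_le.2 le_rfl)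
  rw [this]
  exact (measurableSet_upperCentralSeries_eq_top n).inter
    (measurableSet_forall fun k => (measurableSet_upperCentralSeries_eq_top k).compl)

end GpOmega

/-- The space of nilpotent groups of class `n` with domain `ℕ`, with the Borel structure inherited
from the space of all groups with domain `ℕ`. -/
def NiGp (n : ℕ) : Type :=
  {G : GpOmega // Group.IsNilpotent G.Carrier ∧ Group.nilpotencyClass G.Carrier = n}

instance (n : ℕ) : MeasurableSpace (NiGp n) :=
  inferInstanceAs (MeasurableSpace
    {G : GpOmega // Group.IsNilpotent G.Carrier ∧ Group.nilpotencyClass G.Carrier = n})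

instance (n : ℕ) : StandardBorelSpace (NiGp n) :=
  (GpOmega.measurableSet_nilpotencyClass_eq n).standardBorel

/-! ### Co-Hopfian groups -/

/-- A group is co-Hopfian if every injective endomorphism of it is surjective. -/
def IsCoHopfian (G : Type u) [Group G] : Prop :=
  ∀ f : G →* G, Function.Injective f → Function.Surjective f

/-! Failure of co-Hopficity is witnessed by a function `ℕ → ℕ` subject to conditions that quantify
only over `ℕ`, so the co-Hopfian groups form a co-analytic set (`isCoanalyticIn_isCoHopfian`). For
hardness, an analytic set is described by trees `T y` depending on `y` in a Borel way, with `y` in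
the set exactly when `T y` has an infinite branch (`MeasureTheory.AnalyticSet.exists_tree`). It
remains to attach to a tree, in a Borel way, a class 2 group that is co-Hopfian if and only if the
tree has no infinite branch.

The group is an extension of a free abelian group on `J` by a torsion module `P × U`, where the
generator `j` acts as `1 + D j` and all products `D i ∘ D j` vanish. The part `P` is a sum of cyclic
groups of order `q ^ 2`, with infinitely many odd primes `q` for each `j`; it forces every injective
endomorphism to induce the identity on the free abelian quotient (`UnipotentExt.base_map_eq`). Hence
co-Hopficity becomes a question about injective endomorphisms of the `ZMod 2`-space `U` commuting
with the operators (`UnipotentExt.isCoHopfian_iff`).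

These operators encode a partial order `R`: a commuting map can send the basis vector at `s` only to
nodes above `s`, up to pairs and the base vector. If there is no infinite ascending chain,
well-founded induction from the top gives surjectivity (`OrderBasis.surjective_of_wellFounded`).
Along an infinite chain, `1 + shift` is injective, commutes and is not surjective
(`OrderBasis.exists_injective_not_surjective`). -/

/-! ### Class two extensions of a free abelian group -/

section Extension

variable {J M : Type*} [AddCommGroup M]

/-- The action of the free abelian group on `J` by a family of additive endomorphisms. -/
noncomputable def freeAction (D : J → (M →+ M)) : (J →₀ ℤ) →+ (M →+ M) :=
  Finsupp.liftAddHom fun j => (zmultiplesHom (M →+ M)) (D j)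

theorem freeAction_single (D : J → (M →+ M)) (j : J) :
    freeAction D (Finsupp.single j 1) = D j := by
  simp [freeAction]

theorem freeAction_apply (D : J → (M →+ M)) (a : J →₀ ℤ) (v : M) :
    freeAction D a v = ∑ j ∈ a.support, a j • D j v := by
  simp [freeAction, Finsupp.sum, AddMonoidHom.finsetSum_apply]

theorem freeAction_freeAction {D : J → (M →+ M)} (hD : ∀ i j v, D i (D j v) = 0)
    (a b : J →₀ ℤ) (v : M) : freeAction D a (freeAction D b v) = 0 := by
  simp [freeAction_apply, map_sum, map_zsmul, hD]

theorem commute_freeAction {N : Type*} [AddCommGroup N] {D : J → (M →+ M)}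
    {E : J → (N →+ N)} {F : M →+ N} (h : ∀ j v, E j (F v) = F (D j v)) (a : J →₀ ℤ)
    (v : M) : freeAction E a (F v) = F (freeAction D a v) := by
  simp [freeAction_apply, map_sum, map_zsmul, h]

/-- The extension of the free abelian group on `J` by `M` in which the generator `j` acts on `M`
as `1 + D j`. -/
@[ext]
structure UnipotentExt (D : J → (M →+ M)) (hD : ∀ i j v, D i (D j v) = 0) where
  /-- The component in the free abelian group. -/
  base : J →₀ ℤ
  /-- The component in `M`. -/
  fib : M

namespace UnipotentExt

variable {D : J → (M →+ M)} {hD : ∀ i j v, D i (D j v) = 0}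

noncomputable instance : Mul (UnipotentExt D hD) :=
  ⟨fun g h => ⟨g.base + h.base, g.fib + h.fib + freeAction D g.base h.fib⟩⟩

instance : One (UnipotentExt D hD) := ⟨⟨0, 0⟩⟩

noncomputable instance : Inv (UnipotentExt D hD) :=
  ⟨fun g => ⟨-g.base, -g.fib + freeAction D g.base g.fib⟩⟩

@[simp] theorem base_mul (g h : UnipotentExt D hD) : (g * h).base = g.base + h.base := rfl

@[simp] theorem fib_mul (g h : UnipotentExt D hD) :
    (g * h).fib = g.fib + h.fib + freeAction D g.base h.fib := rfl

@[simp] theorem base_one : (1 : UnipotentExt D hD).base = 0 := rfl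

@[simp] theorem fib_one : (1 : UnipotentExt D hD).fib = 0 := rfl

@[simp] theorem base_inv (g : UnipotentExt D hD) : g⁻¹.base = -g.base := rfl

@[simp] theorem fib_inv (g : UnipotentExt D hD) :
    g⁻¹.fib = -g.fib + freeAction D g.base g.fib := rfl

noncomputable instance : Group (UnipotentExt D hD) :=
  Group.ofLeftAxioms
    (fun g h k => by
      ext1
      · simp [add_assoc]
      · simp [freeAction_freeAction hD, AddMonoidHom.add_apply]
        abel)
    (fun g => by ext1 <;> simp)
    (fun g => by
      ext1
      · simp
      · simp [AddMonoidHom.neg_apply])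

/-- Pairs as elements of the extension. -/
def equivProd : UnipotentExt D hD ≃ (J →₀ ℤ) × M where
  toFun g := (g.base, g.fib)
  invFun x := ⟨x.1, x.2⟩

instance [Countable J] [Countable M] : Countable (UnipotentExt D hD) :=
  equivProd.injective.countable

instance [Nonempty J] : Infinite (UnipotentExt D hD) := by
  have : Infinite ((J →₀ ℤ) × M) := inferInstance
  exact equivProd.infinite_iff.2 this

theorem base_pow (g : UnipotentExt D hD) (k : ℕ) : (g ^ k).base = k • g.base := by
  induction k with
  | zero => simp
  | succ k ih => simp [pow_succ, ih, add_smul]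

theorem pow_of_base_eq_zero {g : UnipotentExt D hD} (h : g.base = 0) (k : ℕ) :
    g ^ k = ⟨0, k • g.fib⟩ := by
  induction k with
  | zero => ext1 <;> simp
  | succ k ih => ext1 <;> simp [pow_succ, ih, add_smul, h]

theorem mk_zero_mul (v : M) (g : UnipotentExt D hD) :
    ⟨0, v⟩ * g = ⟨g.base, v + g.fib⟩ := by
  ext1 <;> simp

/-- This explicit commutator yields both the nilpotency class and, for `h` in the fibre, the
recovery of the action from the group law. -/
theorem commutator_eq (g h : UnipotentExt D hD) :
    g * h = ⟨0, freeAction D g.base h.fib - freeAction D h.base g.fib⟩ * (h * g) := by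
  rw [mk_zero_mul]
  ext1
  · simp [add_comm]
  · simp
    abel

/-- Commutators lie in the fibre, in the span of the images of the `D j`; since all `D i` kill these
images, commutators are central. A nonzero `D j v` is a nontrivial commutator. -/
theorem isNilpotent_and_nilpotencyClass (h : ∃ j v, D j v ≠ 0) :
    Group.IsNilpotent (UnipotentExt D hD) ∧
      Group.nilpotencyClass (UnipotentExt D hD) = 2 := by
  have hc : ∀ z : UnipotentExt D hD, z.base = 0 → (∀ a, freeAction D a z.fib = 0) →
      z ∈ Subgroup.upperCentralSeries (UnipotentExt D hD) 1 := by
    intro z hz hz'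
    rw [Subgroup.upperCentralSeries_one, Subgroup.mem_center_iff]
    intro g
    rw [commutator_eq]
    ext1 <;> simp [hz, hz']
  have htop : Subgroup.upperCentralSeries (UnipotentExt D hD) 2 = ⊤ := by
    rw [Subgroup.eq_top_iff']
    intro g
    rw [Subgroup.mem_upperCentralSeries_succ_iff]
    intro y
    rw [commutatorElement_def, commutator_eq g y, mul_assoc, mul_assoc, mul_assoc y g]
    simp only [mul_inv_cancel_left, mul_inv_cancel, mul_one]
    refine hc _ rfl fun a => ?_
    simp [freeAction_freeAction hD]
  have hnil : Group.IsNilpotent (UnipotentExt D hD) := ⟨2, htop⟩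
  refine ⟨hnil, le_antisymm
    (Subgroup.upperCentralSeries_eq_top_iff_nilpotencyClass_le.1 htop) ?_⟩
  by_contra! hlt
  have h1 : Subgroup.upperCentralSeries (UnipotentExt D hD) 1 = ⊤ :=
    Subgroup.upperCentralSeries_eq_top_iff_nilpotencyClass_le.2 (by omega)
  rw [Subgroup.upperCentralSeries_one, Subgroup.eq_top_iff'] at h1
  obtain ⟨j, v, hv⟩ := h
  have := congrArg fib (Subgroup.mem_center_iff.1 (h1 ⟨0, v⟩) ⟨Finsupp.single j 1, 0⟩)
  simp [freeAction_single] at this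
  exact hv this

/-- An endomorphism of the fibre that commutes with the action induces an endomorphism. -/
noncomputable def mapFib (F : M →+ M) (hF : ∀ j v, D j (F v) = F (D j v)) :
    UnipotentExt D hD →* UnipotentExt D hD :=
  MonoidHom.mk' (fun g => ⟨g.base, F g.fib⟩) fun g h => by
    ext1
    · simp
    · simp [commute_freeAction (F := F) hF]

/-! ### Endomorphisms of an extension with torsion fibre. -/

section Endomorphism

/-- The fibre is torsion, while the quotient by it is torsion-free. -/
theorem base_map_eq_zero (hM : ∀ v : M, ∃ k : ℕ, k ≠ 0 ∧ k • v = 0)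
    (f : UnipotentExt D hD →* UnipotentExt D hD) (v : M) :
    (f ⟨0, v⟩).base = 0 := by
  obtain ⟨k, hk, hkv⟩ := hM v
  have h1 : (⟨0, v⟩ : UnipotentExt D hD) ^ k = 1 := by
    rw [pow_of_base_eq_zero rfl]
    ext1 <;> simp [hkv]
  have h2 := congrArg base (congrArg f h1)
  rw [map_pow, base_pow, map_one, base_one] at h2
  exact (smul_eq_zero.1 h2).resolve_left hk

/-- The restriction of an endomorphism to a torsion fibre. -/
noncomputable def fibMap (hM : ∀ v : M, ∃ k : ℕ, k ≠ 0 ∧ k • v = 0)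
    (f : UnipotentExt D hD →* UnipotentExt D hD) : M →+ M :=
  AddMonoidHom.mk' (fun v => (f ⟨0, v⟩).fib) fun v w => by
    have : (⟨0, v + w⟩ : UnipotentExt D hD) = ⟨0, v⟩ * ⟨0, w⟩ := by
      ext1 <;> simp
    rw [this, map_mul, fib_mul, base_map_eq_zero hM, map_zero, AddMonoidHom.zero_apply, add_zero]

theorem map_mk_zero (hM : ∀ v : M, ∃ k : ℕ, k ≠ 0 ∧ k • v = 0)
    (f : UnipotentExt D hD →* UnipotentExt D hD) (v : M) :
    f ⟨0, v⟩ = ⟨0, fibMap hM f v⟩ :=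
  UnipotentExt.ext (base_map_eq_zero hM f v) rfl

theorem fibMap_injective (hM : ∀ v : M, ∃ k : ℕ, k ≠ 0 ∧ k • v = 0)
    {f : UnipotentExt D hD →* UnipotentExt D hD} (hf : Function.Injective f) :
    Function.Injective (fibMap hM f) := by
  intro v w h
  have := @hf ⟨0, v⟩ ⟨0, w⟩ (by rw [map_mk_zero hM, map_mk_zero hM, h])
  exact congrArg fib this

/-- The commutator of `g` with `⟨0, v⟩` is the action of `g.base` on `v`, and `f` preserves
commutators. -/
theorem freeAction_fibMap (hM : ∀ v : M, ∃ k : ℕ, k ≠ 0 ∧ k • v = 0)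
    (f : UnipotentExt D hD →* UnipotentExt D hD) (g : UnipotentExt D hD) (v : M) :
    freeAction D (f g).base (fibMap hM f v) = fibMap hM f (freeAction D g.base v) := by
  have h := congrArg f (commutator_eq g ⟨0, v⟩)
  rw [map_mul, map_mul, map_mul, map_mk_zero hM, map_mk_zero hM,
    commutator_eq (f g)] at h
  have := congrArg fib (mul_right_cancel h)
  simpa using this

end Endomorphism

end UnipotentExt

end Extension

/-! ### Rigidifying the free abelian group by cyclic groups of order `q ^ 2` -/

theorem eq_zero_of_coprime_nsmul {A : Type*} [AddGroup A] {m k : ℕ} (h : m.Coprime k) {x : A}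
    (hm : m • x = 0) (hk : k • x = 0) : x = 0 := by
  have := Nat.dvd_gcd (addOrderOf_dvd_of_nsmul_eq_zero hm) (addOrderOf_dvd_of_nsmul_eq_zero hk)
  rw [h.gcd_eq_one, Nat.dvd_one] at this
  exact AddMonoid.addOrderOf_eq_one_iff.1 this

section Rigid

variable {J U : Type*} [AddCommGroup U]

/-- The direct sum of the cyclic groups of order `q i ^ 2`. -/
abbrev PrimaryPart (q : J × ℕ → ℕ) : Type _ := Π₀ i, ZMod (q i ^ 2)

open Classical in
/-- Multiplication by `q i` on the summands belonging to `j`. -/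
noncomputable def primaryShift (q : J × ℕ → ℕ) (j : J) : PrimaryPart q →+ PrimaryPart q :=
  DFinsupp.mapRange.addMonoidHom fun i =>
    if i.1 = j then q i • AddMonoidHom.id (ZMod (q i ^ 2)) else 0

open Classical in
theorem primaryShift_apply (q : J × ℕ → ℕ) (j : J) (p : PrimaryPart q) (i : J × ℕ) :
    primaryShift q j p i = if i.1 = j then q i • p i else 0 := by
  simp only [primaryShift, DFinsupp.mapRange.addMonoidHom_apply, DFinsupp.mapRange_apply]
  split_ifs <;> simp

theorem primaryShift_primaryShift (q : J × ℕ → ℕ) (j k : J) (p : PrimaryPart q) :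
    primaryShift q j (primaryShift q k p) = 0 := by
  ext i
  simp only [primaryShift_apply, DFinsupp.zero_apply]
  split_ifs
  · rw [smul_smul, ← pow_two, nsmul_eq_mul, CharP.cast_eq_zero, zero_mul]
  all_goals simp

/-- The operators `n j` on `U`, extended to the direct sum with the primary part. -/
noncomputable def rigidAction (q : J × ℕ → ℕ) (n : J → (U →+ U)) (j : J) :
    PrimaryPart q × U →+ PrimaryPart q × U :=
  (primaryShift q j).prodMap (n j)

theorem rigidAction_rigidAction (q : J × ℕ → ℕ) {n : J → (U →+ U)}
    (hn : ∀ i j u, n i (n j u) = 0) (i j : J) (v : PrimaryPart q × U) :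
    rigidAction q n i (rigidAction q n j v) = 0 := by
  simp [rigidAction, primaryShift_primaryShift, hn, Prod.ext_iff]

-- On the summand `i` only the coordinate `a i.1` acts. As the order is `q i ^ 2`, the action
-- determines this coordinate modulo `q i`.
open Classical in
theorem freeAction_rigidAction_single (q : J × ℕ → ℕ) (n : J → (U →+ U)) (a : J →₀ ℤ)
    (i : J × ℕ) (c : ZMod (q i ^ 2)) :
    freeAction (rigidAction q n) a (DFinsupp.single i c, 0) =
      (a i.1 * q i : ℤ) • ((DFinsupp.single i c, 0) : PrimaryPart q × U) := by
  have h : ∀ j, rigidAction q n j (DFinsupp.single i c, 0) =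
      if i.1 = j then q i • ((DFinsupp.single i c, 0) : PrimaryPart q × U) else 0 := by
    intro j
    rw [rigidAction, AddMonoidHom.prodMap, AddMonoidHom.prod_apply]
    have : primaryShift q j (DFinsupp.single i c) =
        if i.1 = j then q i • (DFinsupp.single i c : PrimaryPart q) else 0 := by
      ext k
      rw [primaryShift_apply]
      by_cases hk : i = k
      · subst hk
        split_ifs <;> simp
      · rw [DFinsupp.single_eq_of_ne (Ne.symm hk)]
        split_ifs <;> simp [DFinsupp.single_eq_of_ne (Ne.symm hk)]
    ext1
    · simp [this]
      split_ifs <;> simp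
    · simp
      split_ifs <;> simp
  simp only [freeAction_apply, h, smul_ite, smul_zero, Finset.sum_ite_eq]
  split_ifs with hs
  · rw [mul_smul, natCast_zsmul]
  · rw [Finsupp.notMem_support_iff.1 hs, zero_mul, zero_smul]

section

variable {q : J × ℕ → ℕ} (hq : ∀ i, (q i).Prime) (hq2 : ∀ i, q i ≠ 2)
  (hU : ∀ u : U, 2 • u = 0)

include hq hU in
theorem exists_nsmul_eq_zero (v : PrimaryPart q × U) : ∃ k : ℕ, k ≠ 0 ∧ k • v = 0 := by
  classical
  refine ⟨2 * ∏ i ∈ v.1.support, q i ^ 2, ?_, ?_⟩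
  · exact mul_ne_zero two_ne_zero (Finset.prod_ne_zero_iff.2 fun i _ => pow_ne_zero _ (hq i).ne_zero)
  · ext1
    · ext i
      rw [Prod.smul_fst, DFinsupp.smul_apply, Prod.fst_zero, DFinsupp.zero_apply]
      by_cases hi : i ∈ v.1.support
      · obtain ⟨k, hk⟩ := (Finset.dvd_prod_of_mem (fun i => q i ^ 2) hi).mul_left 2
        rw [hk, nsmul_eq_mul, Nat.cast_mul, CharP.cast_eq_zero, zero_mul, zero_mul]
      · rw [DFinsupp.notMem_support_iff.1 hi, smul_zero]
    · rw [Prod.smul_snd, mul_comm, mul_smul, hU, smul_zero, Prod.snd_zero]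

include hq hq2 hU in
theorem eq_single_of_nsmul_eq_zero [DecidableEq J] (hinj : Function.Injective q) {i : J × ℕ}
    {v : PrimaryPart q × U} (h : q i ^ 2 • v = 0) : v = (DFinsupp.single i (v.1 i), 0) := by
  ext1
  · ext k
    by_cases hk : i = k
    · subst hk
      simp
    · rw [DFinsupp.single_eq_of_ne (Ne.symm hk)]
      have h1 : q i ^ 2 • v.1 k = 0 := by
        rw [← DFinsupp.smul_apply, ← Prod.smul_fst, h]
        rfl
      refine eq_zero_of_coprime_nsmul (Nat.Coprime.pow 2 2 ?_) h1
        (show q k ^ 2 • v.1 k = 0 by rw [nsmul_eq_mul, CharP.cast_eq_zero, zero_mul])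
      exact (Nat.coprime_primes (hq i) (hq k)).2 fun e => hk (hinj e)
  · have h1 : q i ^ 2 • v.2 = 0 := by
      rw [← Prod.smul_snd, h]
      rfl
    refine eq_zero_of_coprime_nsmul (Nat.Coprime.pow_left 2 ?_) h1 (hU v.2)
    exact (Nat.coprime_primes (hq i) Nat.prime_two).2 (hq2 i)

include hq hq2 in
theorem fst_eq_zero_of_two_nsmul {v : PrimaryPart q × U} (h : 2 • v = 0) : v.1 = 0 := by
  ext k
  have h1 : 2 • v.1 k = 0 := by
    rw [← DFinsupp.smul_apply, ← Prod.smul_fst, h]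
    rfl
  refine eq_zero_of_coprime_nsmul (Nat.Coprime.pow_right 2 ?_) h1
    (show q k ^ 2 • v.1 k = 0 by rw [nsmul_eq_mul, CharP.cast_eq_zero, zero_mul])
  exact (Nat.coprime_primes Nat.prime_two (hq k)).2 (hq2 k).symm

-- The summand `i` is the full `q i ^ 2`-torsion, so `F` maps it into itself; being finite, it is
-- mapped onto itself.
include hq hq2 hU in
theorem exists_map_single_eq [DecidableEq J] (hinj : Function.Injective q)
    {F : PrimaryPart q × U →+ PrimaryPart q × U} (hF : Function.Injective F) (i : J × ℕ)
    (c : ZMod (q i ^ 2)) :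
    ∃ d, F (DFinsupp.single i d, 0) = (DFinsupp.single i c, 0) := by
  have : NeZero (q i ^ 2) := ⟨pow_ne_zero _ (hq i).ne_zero⟩
  have h : ∀ d, F (DFinsupp.single i d, 0) =
      (DFinsupp.single i ((F (DFinsupp.single i d, 0)).1 i), 0) := by
    intro d
    refine eq_single_of_nsmul_eq_zero hq hq2 hU hinj ?_
    rw [← map_nsmul]
    convert map_zero F
    ext1
    · rw [Prod.smul_fst, ← DFinsupp.single_smul, nsmul_eq_mul, CharP.cast_eq_zero, zero_mul,
        DFinsupp.single_zero, Prod.fst_zero]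
    · simp
  have hinj' : Function.Injective fun d => (F (DFinsupp.single i d, 0)).1 i := by
    intro d e hde
    have h1 : F (DFinsupp.single i d, 0) = F (DFinsupp.single i e, 0) := by
      rw [h d, h e]
      exact congrArg (fun c => (DFinsupp.single i c, (0 : U))) hde
    exact DFinsupp.single_injective (β := fun k => ZMod (q k ^ 2)) (congrArg Prod.fst (hF h1))
  obtain ⟨d, hd⟩ := Finite.surjective_of_injective hinj' c
  exact ⟨d, by rw [h d]; exact congrArg (fun c => (DFinsupp.single i c, (0 : U))) hd⟩

-- Comparing the actions of `f g` and `g` on the summand `(j, k)` shows that their coordinates at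
-- `j` agree modulo `q (j, k)`. This holds for infinitely many primes, so they are equal.
include hq hq2 hU in
theorem UnipotentExt.base_map_eq (hinj : Function.Injective q) {n : J → (U →+ U)}
    {hD : ∀ i j v, rigidAction q n i (rigidAction q n j v) = 0}
    {f : UnipotentExt (rigidAction q n) hD →* UnipotentExt (rigidAction q n) hD}
    (hf : Function.Injective f) (g : UnipotentExt (rigidAction q n) hD) :
    (f g).base = g.base := by
  classical
  have hM := exists_nsmul_eq_zero (U := U) hq hU
  have hdvd : ∀ i : J × ℕ, (q i : ℤ) ∣ (f g).base i.1 - g.base i.1 := by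
    intro i
    obtain ⟨d, hd⟩ := exists_map_single_eq hq hq2 hU hinj (fibMap_injective hM hf) i 1
    have h := freeAction_fibMap hM f g (DFinsupp.single i d, 0)
    rw [hd, freeAction_rigidAction_single, freeAction_rigidAction_single, map_zsmul, hd,
      ← sub_eq_zero, ← sub_smul] at h
    have h1 := DFunLike.congr_fun (congrArg Prod.fst h) i
    rw [Prod.smul_fst, DFinsupp.smul_apply, DFinsupp.single_eq_same, Prod.fst_zero,
      DFinsupp.zero_apply, zsmul_one, ZMod.intCast_zmod_eq_zero_iff_dvd, ← sub_mul,
      Nat.cast_pow, pow_two] at h1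
    -- `h1` says that `q i ^ 2` divides the difference times `q i`; one factor cancels.
    exact Int.dvd_of_mul_dvd_mul_right (by exact_mod_cast (hq i).ne_zero) h1
  ext j
  by_contra hne
  have hinf : Function.Injective fun k : ℕ => q (j, k) := fun k l h => by
    simpa using hinj h
  obtain ⟨k, hk⟩ := (Set.infinite_range_of_injective hinf).exists_gt
    ((f g).base j - g.base j).natAbs
  obtain ⟨⟨k, rfl⟩, hk⟩ := hk
  have := Nat.le_of_dvd (Int.natAbs_pos.2 (sub_ne_zero.2 hne))
    (Int.natCast_dvd.1 (hdvd (j, k)))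
  simp only at hk
  omega

include hq hq2 hU in
/-- The extension is co-Hopfian if and only if the family of operators on `U` is. -/
theorem UnipotentExt.isCoHopfian_iff (hinj : Function.Injective q) {n : J → (U →+ U)}
    {hD : ∀ i j v, rigidAction q n i (rigidAction q n j v) = 0} :
    IsCoHopfian (UnipotentExt (rigidAction q n) hD) ↔
      ∀ g : U →+ U, Function.Injective g → (∀ j u, n j (g u) = g (n j u)) →
        Function.Surjective g := by
  classical
  constructor
  · intro h g hg hn u
    have hF : ∀ j v, rigidAction q n j ((AddMonoidHom.id _).prodMap g v) =
        (AddMonoidHom.id _).prodMap g (rigidAction q n j v) := by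
      rintro j ⟨p, u⟩
      simp [rigidAction, hn]
    have hinj : Function.Injective (mapFib (hD := hD) _ hF) := by
      rintro ⟨a, p, u⟩ ⟨b, r, w⟩ hab
      simp only [mapFib, MonoidHom.mk'_apply, UnipotentExt.mk.injEq] at hab
      obtain ⟨rfl, hab⟩ := hab
      simp only [AddMonoidHom.coe_prodMap, Prod.map_apply, Prod.mk.injEq] at hab
      obtain ⟨hpr, huw⟩ := hab
      cases hg huw
      cases hpr
      rfl
    obtain ⟨⟨a, p, w⟩, hw⟩ := h _ hinj ⟨0, 0, u⟩
    exact ⟨w, congrArg (fun x => x.fib.2) hw⟩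
  · intro h f hf
    have hM := exists_nsmul_eq_zero (U := U) hq hU
    set F := fibMap hM f with hFdef
    have hF : Function.Injective F := fibMap_injective hM hf
    have hbase := base_map_eq hq hq2 hU hinj hf
    have hcomm : ∀ j v, rigidAction q n j (F v) = F (rigidAction q n j v) := by
      intro j v
      have := freeAction_fibMap hM f ⟨Finsupp.single j 1, 0⟩ v
      rwa [hbase, freeAction_single] at this
    -- `U` is the 2-torsion of the fibre because all `q i` are odd, so `F` preserves it.
    have hF2 : ∀ u, F (0, u) = (0, (F (0, u)).2) := by
      intro u
      ext1
      · refine fst_eq_zero_of_two_nsmul hq hq2 ?_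
        rw [← map_nsmul, Prod.smul_mk, smul_zero, hU, Prod.mk_zero_zero, map_zero]
      · rfl
    have hsnd : Function.Surjective
        (((AddMonoidHom.snd _ _).comp F).comp (AddMonoidHom.inr (PrimaryPart q) U)) := by
      refine h _ ?_ ?_
      · intro u w huw
        simp only [AddMonoidHom.comp_apply, AddMonoidHom.inr_apply, AddMonoidHom.coe_snd] at huw
        have := @hF (0, u) (0, w) (by rw [hF2, hF2 w, huw])
        exact congrArg Prod.snd this
      · intro j u
        have := congrArg Prod.snd (hcomm j (0, u))
        simpa [rigidAction] using this
    have hsurj : ∀ v, v ∈ F.range := by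
      rintro ⟨p, u⟩
      have hp : ∀ p : PrimaryPart q, (p, (0 : U)) ∈ F.range := by
        intro p
        induction p using DFinsupp.induction with
        | h0 => exact F.range.zero_mem
        | ha i c p _ _ ih =>
          obtain ⟨d, hd⟩ := exists_map_single_eq hq hq2 hU hinj hF i c
          have := F.range.add_mem ⟨_, hd⟩ ih
          simpa using this
      have hu : ((0 : PrimaryPart q), u) ∈ F.range := by
        obtain ⟨w, hw⟩ := hsnd u
        refine ⟨(0, w), ?_⟩
        rw [hF2]
        simpa using hw
      simpa using F.range.add_mem (hp p) hu
    rintro ⟨a, v⟩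
    -- Since `f ⟨a, 0⟩` already has base `a`, only its fibre component needs correcting.
    obtain ⟨w, hw⟩ := hsurj (v - (f ⟨a, 0⟩).fib)
    refine ⟨⟨0, w⟩ * ⟨a, 0⟩, ?_⟩
    rw [map_mul, map_mk_zero hM, mk_zero_mul, hbase, ← hFdef, hw, sub_add_cancel]

end

end Rigid

/-! ### Partial functions acting on a vector space over the field with two elements -/

section PartialMap

theorem zmod_two_eq_one : ∀ {a : ZMod 2}, a ≠ 0 → a = 1 := by decide

variable {I : Type*}

/-- The linear map that sends a basis vector `i` to the basis vector `φ i`, or to `0` where `φ` is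
undefined. -/
noncomputable def partialMap (φ : I → Option I) : (I →₀ ZMod 2) →ₗ[ZMod 2] (I →₀ ZMod 2) :=
  Finsupp.linearCombination (ZMod 2) fun i => (φ i).elim 0 fun k => Finsupp.single k 1

theorem partialMap_single (φ : I → Option I) (i : I) :
    partialMap φ (Finsupp.single i 1) = (φ i).elim 0 fun k => Finsupp.single k 1 := by
  simp [partialMap]

theorem partialMap_apply_of_forall_ne {φ : I → Option I} {k : I} (h : ∀ i, φ i ≠ some k)
    (x : I →₀ ZMod 2) : partialMap φ x k = 0 := by
  rw [partialMap, Finsupp.linearCombination_apply, Finsupp.sum, Finsupp.finsetSum_apply]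
  refine Finset.sum_eq_zero fun i _ => ?_
  have := h i
  cases hi : φ i with
  | none => simp
  | some l =>
    have hlk : k ≠ l := by
      rintro rfl
      exact this hi
    simp [hlk]

theorem partialMap_apply_of_eq_some {φ : I → Option I} {i k : I} (h : φ i = some k)
    (hφ : ∀ j, φ j = some k → j = i) (x : I →₀ ZMod 2) : partialMap φ x k = x i := by
  have hne : ∀ j, j ≠ i → ((φ j).elim 0 fun l => Finsupp.single l (1 : ZMod 2)) k = 0 := by
    intro j hj
    cases hl : φ j with
    | none => simp
    | some l =>
      have hlk : k ≠ l := by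
        rintro rfl
        exact hj (hφ j hl)
      simp [hlk]
  rw [partialMap, Finsupp.linearCombination_apply, Finsupp.sum, Finsupp.finsetSum_apply,
    Finset.sum_eq_single i]
  · simp [h]
  · intro j _ hj
    rw [Finsupp.smul_apply, hne j hj, smul_zero]
  · intro hi
    rw [Finsupp.notMem_support_iff.1 hi, zero_smul, Finsupp.zero_apply]

theorem partialMap_partialMap (φ ψ : I → Option I) (x : I →₀ ZMod 2) :
    partialMap φ (partialMap ψ x) = partialMap (fun i => (ψ i).bind φ) x := by
  induction x using Finsupp.induction_linear with
  | zero => simp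
  | add x y hx hy => simp only [map_add, hx, hy]
  | single i c =>
    rw [← mul_one c, ← smul_eq_mul, ← Finsupp.smul_single, map_smul, map_smul, map_smul,
      partialMap_single, partialMap_single]
    cases h : ψ i with
    | none => simp
    | some k => simp [partialMap_single]

theorem partialMap_none (x : I →₀ ZMod 2) : partialMap (fun _ => none) x = 0 := by
  ext k
  exact partialMap_apply_of_forall_ne (by simp) x

theorem mem_of_forall_single_mem {Q : AddSubgroup (I →₀ ZMod 2)} {x : I →₀ ZMod 2}
    (h : ∀ i, x i ≠ 0 → Finsupp.single i 1 ∈ Q) : x ∈ Q := by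
  rw [← Finsupp.sum_single x]
  refine Q.sum_mem fun i hi => ?_
  have hi' := Finsupp.mem_support_iff.1 hi
  rw [zmod_two_eq_one hi']
  exact h i hi'

theorem two_nsmul_eq_zero_of_zmod_two (x : I →₀ ZMod 2) : 2 • x = 0 := by
  ext i
  rw [Finsupp.smul_apply, nsmul_eq_mul, CharP.cast_eq_zero, zero_mul, Finsupp.zero_apply]

end PartialMap

/-! ### The operators attached to a partial order -/

/-- The basis on which the operators attached to a relation on `S` act. -/
inductive OrderBasis (S : Type*)
  | node : S → OrderBasis S
  | pair : S → S → OrderBasis S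
  | base : OrderBasis S

namespace OrderBasis

variable {S : Type*}

instance [Countable S] : Countable (OrderBasis S) := by
  let f : OrderBasis S → S ⊕ (S × S) ⊕ Unit
    | node s => .inl s
    | pair t s => .inr (.inl (t, s))
    | base => .inr (.inr ())
  refine Function.Injective.countable (f := f) ?_
  rintro (s | ⟨t, s⟩ | _) (s' | ⟨t', s'⟩ | _) h <;> simp_all [f]

open Classical in
/-- The operator `t` moves `node s` to `pair t s` unless `R t s`; the operator `(t, s)` moves
`pair t s` to `base` if `R t s`. -/
noncomputable def move (R : S → S → Prop) : S ⊕ S × S → OrderBasis S → Option (OrderBasis S)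
  | .inl t, node s => if R t s then none else some (pair t s)
  | .inr (t, s), pair t' s' => if t' = t ∧ s' = s ∧ R t s then some base else none
  | _, _ => none

/-- The operators on the vector space with basis `OrderBasis S`. -/
noncomputable def operator (R : S → S → Prop) (j : S ⊕ S × S) :
    (OrderBasis S →₀ ZMod 2) →+ (OrderBasis S →₀ ZMod 2) :=
  (partialMap (move R j)).toAddMonoidHom

theorem operator_apply (R : S → S → Prop) (j : S ⊕ S × S) (x : OrderBasis S →₀ ZMod 2) :
    operator R j x = partialMap (move R j) x := rfl

variable {R : S → S → Prop}

theorem operator_operator (i j : S ⊕ S × S) (x : OrderBasis S →₀ ZMod 2) :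
    operator R i (operator R j x) = 0 := by
  rw [operator_apply, operator_apply, partialMap_partialMap, ← partialMap_none x]
  congr 2
  funext k
  rcases i with t | ⟨t, s⟩ <;> rcases j with t' | ⟨t', s'⟩ <;> rcases k with r | ⟨r, r'⟩ | _ <;>
    simp only [move, Option.bind_none] <;> split_ifs with h <;> simp [move]
  rintro rfl rfl
  exact h

/-- The operator `t` thus detects the node coordinates outside the cone above `t`, which a commuting
map must respect. -/
theorem operator_inl_pair {t s : S} (h : ¬ R t s) (x : OrderBasis S →₀ ZMod 2) :
    operator R (.inl t) x (pair t s) = x (node s) := by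
  refine partialMap_apply_of_eq_some (by simp [move, h]) ?_ x
  rintro (r | ⟨t', s'⟩ | _) hr
  · simp only [move] at hr
    split_ifs at hr
    simp_all
  all_goals simp [move] at hr

theorem operator_inl_node {t s : S} (h : R t s) :
    operator R (.inl t) (Finsupp.single (node s) 1) = 0 := by
  simp [operator_apply, partialMap_single, move, h]

theorem operator_inl_node_of_not {t s : S} (h : ¬ R t s) :
    operator R (.inl t) (Finsupp.single (node s) 1) = Finsupp.single (pair t s) 1 := by
  simp [operator_apply, partialMap_single, move, h]

theorem operator_inl_eq_zero {t : S} {x : OrderBasis S →₀ ZMod 2} (h : ∀ s, x (node s) = 0) :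
    operator R (.inl t) x = 0 := by
  ext k
  by_cases hk : ∃ i, move R (.inl t) i = some k
  · obtain ⟨i, hi⟩ := hk
    rcases i with s | ⟨t', s⟩ | _
    · simp only [move] at hi
      split_ifs at hi with hts
      cases hi
      rw [operator_inl_pair hts, h, Finsupp.zero_apply]
    all_goals simp [move] at hi
  · exact partialMap_apply_of_forall_ne (fun i hi => hk ⟨i, hi⟩) x

theorem operator_inr_base {t s : S} (h : R t s) (x : OrderBasis S →₀ ZMod 2) :
    operator R (.inr (t, s)) x base = x (pair t s) := by
  refine partialMap_apply_of_eq_some (by simp [move, h]) ?_ x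
  rintro (r | ⟨t', s'⟩ | _) hr
  · simp [move] at hr
  · simp only [move] at hr
    split_ifs at hr
    simp_all
  · simp [move] at hr

theorem operator_inr_of_ne_base {t s : S} {k : OrderBasis S} (hk : k ≠ base)
    (x : OrderBasis S →₀ ZMod 2) : operator R (.inr (t, s)) x k = 0 := by
  refine partialMap_apply_of_forall_ne ?_ x
  rintro (r | ⟨t', s'⟩ | _) hr
  · simp [move] at hr
  · simp only [move] at hr
    split_ifs at hr
    simp_all
  · simp [move] at hr

theorem operator_inr_pair {t s t' s' : S} (h : R t' s') [Decidable (t' = t ∧ s' = s)] :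
    operator R (.inr (t, s)) (Finsupp.single (pair t' s') 1) =
      if t' = t ∧ s' = s then Finsupp.single base 1 else 0 := by
  rw [operator_apply, partialMap_single]
  simp only [move]
  split_ifs <;> simp_all

/-- The vectors whose coordinates at the nodes are supported on `P`. -/
def nodeSupported (P : S → Prop) : AddSubgroup (OrderBasis S →₀ ZMod 2) where
  carrier := {x | ∀ s, ¬ P s → x (node s) = 0}
  zero_mem' := by simp
  add_mem' {x y} hx hy s hs := by simp [hx s hs, hy s hs]
  neg_mem' {x} hx s hs := by simp [hx s hs]

theorem nodeSupported_mono {P Q : S → Prop} (h : ∀ s, P s → Q s) :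
    nodeSupported P ≤ nodeSupported Q := fun _ hx s hs => hx s fun hp => hs (h s hp)

theorem nodeSupported_le {P : S → Prop} {Q : AddSubgroup (OrderBasis S →₀ ZMod 2)}
    (h : ∀ s, P s → Finsupp.single (node s) 1 ∈ Q)
    (hQ : nodeSupported (fun _ : S => False) ≤ Q) : nodeSupported P ≤ Q := by
  intro x hx
  refine mem_of_forall_single_mem fun i hi => ?_
  cases i with
  | node s => exact h s (by_contra fun hs => hi (hx s hs))
  | pair t s => exact hQ fun s _ => by simp
  | base => exact hQ fun s _ => by simp

/-! ### Surjectivity in the absence of infinite ascending chains. -/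

section WellFounded

variable {g : (OrderBasis S →₀ ZMod 2) →+ (OrderBasis S →₀ ZMod 2)}

/-- Vectors without node coordinates are the common kernel of the operators `.inl t`, because by
`hR` each node is detected by some `t`; an injective commuting map reflects this kernel. -/
theorem mem_nodeSupported_false_of_map (hR : ∀ s, ∃ t, ¬ R t s) (hg : Function.Injective g)
    (hcomm : ∀ j x, operator R j (g x) = g (operator R j x)) {x : OrderBasis S →₀ ZMod 2}
    (h : g x ∈ nodeSupported (fun _ : S => False)) : x ∈ nodeSupported (fun _ : S => False) := by
  intro s _
  obtain ⟨t, ht⟩ := hR s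
  have h1 : g (operator R (.inl t) x) = 0 := by
    rw [← hcomm, operator_inl_eq_zero fun s => h s not_false]
  rw [← operator_inl_pair ht, (map_eq_zero_iff g hg).1 h1, Finsupp.zero_apply]

/-- Modulo pairs and base, `g` is triangular for `R`: it sends node `s` to a multiple of itself plus
nodes strictly above, which are images by induction. Injectivity makes the diagonal coefficient
nonzero. -/
theorem single_node_mem (hrefl : ∀ s, R s s) (htrans : ∀ r s t, R r s → R s t → R r t)
    (hanti : ∀ r s, R r s → R s r → r = s) (hwf : WellFounded fun r s => R s r ∧ r ≠ s)
    (hR : ∀ s, ∃ t, ¬ R t s) (hg : Function.Injective g)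
    (hcomm : ∀ j x, operator R j (g x) = g (operator R j x)) (s : S) :
    Finsupp.single (node s) 1 ∈
      (nodeSupported (R s)).map g ⊔ nodeSupported (fun _ : S => False) := by
  induction s using hwf.induction with
  | _ s ih =>
  have habove : nodeSupported (fun r => R s r ∧ r ≠ s) ≤
      (nodeSupported fun r => R s r ∧ r ≠ s).map g ⊔ nodeSupported (fun _ : S => False) := by
    refine nodeSupported_le (fun r hr => ?_) le_sup_right
    refine sup_le_sup_right (AddSubgroup.map_mono (nodeSupported_mono fun t ht => ?_)) _ (ih r hr)
    refine ⟨htrans _ _ _ hr.1 ht, ?_⟩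
    rintro rfl
    exact hr.2 (hanti _ _ ht hr.1)
  -- By reflexivity the operator `s` kills node `s`, hence also its image.
  have hs : g (Finsupp.single (node s) 1) ∈ nodeSupported (R s) := by
    intro r hr
    rw [← operator_inl_pair hr, hcomm, operator_inl_node (hrefl s), map_zero, Finsupp.zero_apply]
  have hsplit : g (Finsupp.single (node s) 1) -
      Finsupp.single (node s) (g (Finsupp.single (node s) 1) (node s)) ∈
      nodeSupported (fun r => R s r ∧ r ≠ s) := by
    intro r hr
    by_cases hrs : r = s
    · subst hrs
      simp
    · rw [Finsupp.sub_apply, hs r fun h => hr ⟨h, hrs⟩, Finsupp.single_eq_of_ne (by simpa using hrs),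
        sub_zero]
  obtain ⟨_, ⟨a, ha, rfl⟩, z, hz, haz⟩ := AddSubgroup.mem_sup.1 (habove hsplit)
  have hself : Finsupp.single (node s) 1 ∈ nodeSupported (R s) := by
    intro r hr
    refine Finsupp.single_eq_of_ne ?_
    rintro h
    cases h
    exact hr (hrefl _)
  by_cases hc : g (Finsupp.single (node s) 1) (node s) = 0
  -- With zero diagonal coefficient, `g` would send node `s` minus `a` to a vector without node
  -- coordinates, although `a` lives strictly above `s`.
  · exfalso
    rw [hc, Finsupp.single_zero, sub_zero] at haz
    have h1 : g (Finsupp.single (node s) 1 - a) ∈ nodeSupported (fun _ : S => False) := by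
      rw [map_sub, ← haz, add_sub_cancel_left]
      exact hz
    have h2 := mem_nodeSupported_false_of_map hR hg hcomm h1 s not_false
    rw [Finsupp.sub_apply, Finsupp.single_eq_same, ha s (by simp), sub_zero] at h2
    exact one_ne_zero h2
  · rw [zmod_two_eq_one hc] at haz
    have h1 : Finsupp.single (node s) 1 = g (Finsupp.single (node s) 1 - a) + -z := by
      rw [map_sub, sub_eq_iff_eq_add.1 haz.symm]
      abel
    rw [h1]
    refine AddSubgroup.add_mem_sup ⟨_, ?_, rfl⟩ (neg_mem hz)
    exact sub_mem hself (nodeSupported_mono (fun r hr => hr.1) ha)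

/-- If the strict order is well-founded then every injective endomorphism is surjective. -/
theorem surjective_of_wellFounded [Nonempty S] (hrefl : ∀ s, R s s)
    (htrans : ∀ r s t, R r s → R s t → R r t)
    (hanti : ∀ r s, R r s → R s r → r = s) (hwf : WellFounded fun r s => R s r ∧ r ≠ s)
    (hR : ∀ s, ∃ t, ¬ R t s) (hg : Function.Injective g)
    (hcomm : ∀ j x, operator R j (g x) = g (operator R j x)) : Function.Surjective g := by
  classical
  have hnode := single_node_mem hrefl htrans hanti hwf hR hg hcomm
  -- The base vector is the image of `pair s s` under an operator whose range is spanned by the base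
  -- vector.
  have hbase : g (Finsupp.single base 1) = Finsupp.single base 1 := by
    obtain ⟨s⟩ := ‹Nonempty S›
    have h1 := hcomm (.inr (s, s)) (Finsupp.single (pair s s) 1)
    rw [operator_inr_pair (hrefl s), if_pos ⟨rfl, rfl⟩] at h1
    have h2 : g (Finsupp.single base 1) = Finsupp.single base (g (Finsupp.single base 1) base) := by
      ext k
      by_cases hk : k = base
      · rw [hk, Finsupp.single_eq_same]
      · rw [Finsupp.single_eq_of_ne hk, ← h1, operator_inr_of_ne_base hk]
    have h3 : g (Finsupp.single base 1) base ≠ 0 := by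
      intro h
      rw [h, Finsupp.single_zero] at h2
      simpa using (map_eq_zero_iff g hg).1 h2
    rwa [zmod_two_eq_one h3] at h2
  -- Apply the operator `t` to node `s` written as `g a + z`: it kills `z` and gives `pair t s` on
  -- the left.
  have hfree : ∀ t s, ¬ R t s → Finsupp.single (pair t s) 1 ∈ g.range := by
    intro t s hts
    obtain ⟨_, ⟨a, -, rfl⟩, z, hz, haz⟩ := AddSubgroup.mem_sup.1 (hnode s)
    refine ⟨operator R (.inl t) a, ?_⟩
    rw [← operator_inl_node_of_not hts, ← haz, map_add,
      operator_inl_eq_zero fun s => hz s not_false, add_zero, hcomm]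
  have hpair : ∀ t s, Finsupp.single (pair t s) 1 ∈ g.range := by
    intro t s
    by_cases hts : R t s
    -- The operators show that this difference has no coordinates at nodes or at related pairs,
    -- leaving only vectors already known to be in the range.
    · have h : g (Finsupp.single (pair t s) 1) - Finsupp.single (pair t s) 1 ∈ g.range := by
        refine mem_of_forall_single_mem fun i hi => ?_
        cases i with
        | node r =>
          exfalso
          obtain ⟨t', ht'⟩ := hR r
          rw [Finsupp.sub_apply, Finsupp.single_eq_of_ne (by simp), sub_zero,
            ← operator_inl_pair ht', hcomm, operator_inl_eq_zero (by simp), map_zero] at hi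
          exact hi rfl
        | pair t' s' =>
          refine hfree _ _ fun h' => hi ?_
          rw [Finsupp.sub_apply, ← operator_inr_base h', hcomm, operator_inr_pair hts]
          split_ifs with h
          · obtain ⟨rfl, rfl⟩ := h
            rw [hbase, Finsupp.single_eq_same, Finsupp.single_eq_same, sub_self]
          · rw [map_zero, Finsupp.zero_apply, Finsupp.single_eq_of_ne, sub_zero]
            rintro h1
            cases h1
            exact h ⟨rfl, rfl⟩
        | base => exact ⟨_, hbase⟩
      have h' := g.range.sub_mem ⟨Finsupp.single (pair t s) 1, rfl⟩ h
      rwa [sub_sub_cancel] at h'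
    · exact hfree t s hts
  have hker : nodeSupported (fun _ : S => False) ≤ g.range := by
    intro x hx
    refine mem_of_forall_single_mem fun i hi => ?_
    cases i with
    | node s => exact absurd (hx s not_false) hi
    | pair t s => exact hpair t s
    | base => exact ⟨_, hbase⟩
  have htop : (nodeSupported fun _ : S => True) ≤ g.range :=
    nodeSupported_le (fun s _ => sup_le (AddSubgroup.map_le_range _ _) hker (hnode s)) hker
  exact fun x => htop (x := x) fun s hs => absurd trivial hs

end WellFounded

/-! ### A non-surjective injection from an infinite ascending chain. -/

section Chain

variable {c : ℕ → S}

open Classical in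
/-- The successor along a sequence. -/
noncomputable def next (c : ℕ → S) (s : S) : Option S :=
  if h : ∃ n, c n = s then some (c (h.choose + 1)) else none

theorem next_apply (hc : Function.Injective c) (n : ℕ) : next c (c n) = some (c (n + 1)) := by
  have h : ∃ k, c k = c n := ⟨n, rfl⟩
  rw [next, dif_pos h, hc h.choose_spec]

theorem exists_of_next_eq {s r : S} (h : next c s = some r) : ∃ n, s = c n ∧ r = c (n + 1) := by
  rw [next] at h
  split_ifs at h with hs
  exact ⟨hs.choose, hs.choose_spec.symm, (Option.some.inj h).symm⟩

open Classical in
/-- The shift along a sequence. -/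
noncomputable def shift (R : S → S → Prop) (c : ℕ → S) : OrderBasis S → Option (OrderBasis S)
  | node s => (next c s).map node
  | pair t s => (next c s).bind fun r => if R t r then none else some (pair t r)
  | base => none

theorem shift_eq_node {i : OrderBasis S} {r : S} (h : shift R c i = some (node r)) :
    ∃ n, i = node (c n) ∧ r = c (n + 1) := by
  rcases i with s | ⟨t, s⟩ | _
  · simp only [shift, Option.map_eq_some_iff] at h
    obtain ⟨_, h, h'⟩ := h
    cases h'
    obtain ⟨n, rfl, rfl⟩ := exists_of_next_eq h
    exact ⟨n, rfl, rfl⟩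
  · simp only [shift, Option.bind_eq_some_iff] at h
    obtain ⟨_, h, h'⟩ := h
    split_ifs at h'
    cases h'
  · simp [shift] at h

theorem shift_eq_pair {i : OrderBasis S} {t r : S} (h : shift R c i = some (pair t r)) :
    ∃ n, i = pair t (c n) ∧ r = c (n + 1) ∧ ¬ R t r := by
  rcases i with s | ⟨t', s⟩ | _
  · simp [shift] at h
  · simp only [shift, Option.bind_eq_some_iff] at h
    obtain ⟨_, h, h'⟩ := h
    split_ifs at h' with hr
    cases h'
    obtain ⟨n, rfl, rfl⟩ := exists_of_next_eq h
    exact ⟨n, rfl, rfl, hr⟩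
  · simp [shift] at h

theorem shift_ne_base (i : OrderBasis S) : shift R c i ≠ some base := by
  intro h
  rcases i with s | ⟨t', s⟩ | _
  · simp [shift] at h
  · simp only [shift, Option.bind_eq_some_iff] at h
    obtain ⟨_, h, h'⟩ := h
    split_ifs at h'
    cases h'
  · simp [shift] at h

/-- By transitivity `R t s` persists along the chain, so the operators `.inl t` commute with the
shift. For the operators `.inr` both composites vanish: the shift kills the base and never reaches a
related pair. -/
theorem move_bind_shift (htrans : ∀ r s t, R r s → R s t → R r t)
    (hRc : ∀ n, R (c n) (c (n + 1))) (j : S ⊕ S × S) (i : OrderBasis S) :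
    (shift R c i).bind (move R j) = (move R j i).bind (shift R c) := by
  have hstep : ∀ {s r t}, next c s = some r → R t s → R t r := by
    intro s r t h hts
    obtain ⟨n, rfl, rfl⟩ := exists_of_next_eq h
    exact htrans _ _ _ hts (hRc n)
  rcases i with s | ⟨t', s⟩ | _
  · cases h : next c s with
    | none =>
      rcases j with t | ⟨t, s'⟩
      · by_cases hts : R t s <;> simp [move, shift, h, hts]
      · simp [move, shift, h]
    | some r =>
      rcases j with t | ⟨t, s'⟩
      · by_cases hts : R t s
        · simp [move, shift, h, hts, hstep h hts]
        · simp [move, shift, h, hts]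
      · simp [move, shift, h]
  · cases h : next c s with
    | none =>
      rcases j with t | ⟨t, s'⟩
      · simp [move, shift, h]
      · simp only [move, shift, h, Option.bind_none]
        split_ifs <;> simp [shift]
    | some r =>
      rcases j with t | ⟨t, s'⟩
      · by_cases htr : R t' r <;> simp [move, shift, h, htr]
      · by_cases htr : R t' r
        · simp only [move, shift, h, Option.bind_some, htr, if_true, Option.bind_none]
          split_ifs <;> simp [shift]
        · have hno : ¬ (t' = t ∧ r = s' ∧ R t s') := by
            rintro ⟨rfl, rfl, h'⟩
            exact htr h'
          simp only [move, shift, h, Option.bind_some, htr, if_false, hno]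
          split_ifs <;> simp [shift]
  · rcases j with t | ⟨t, s'⟩ <;> simp [move, shift]

/-- Each coordinate of the shifted vector is zero or the coordinate of `x` one step earlier on the
chain, so the coordinates of `x` vanish by induction along the chain. -/
theorem eq_zero_of_shift (hc : Function.Injective c) {x : OrderBasis S →₀ ZMod 2}
    (h : x + partialMap (shift R c) x = 0) : x = 0 := by
  have hz : ∀ k, partialMap (shift R c) x k = 0 → x k = 0 := by
    intro k hk
    have := DFunLike.congr_fun h k
    rwa [Finsupp.add_apply, hk, add_zero] at this
  have hfree : ∀ k, (∀ i, shift R c i ≠ some k) → x k = 0 := fun k hk =>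
    hz k (partialMap_apply_of_forall_ne hk x)
  have hnode : ∀ n, x (node (c n)) = 0 := by
    intro n
    induction n with
    | zero =>
      refine hfree _ fun i hi => ?_
      obtain ⟨n, -, hn⟩ := shift_eq_node hi
      exact absurd (hc hn) (by simp)
    | succ n ih =>
      refine hz _ ((partialMap_apply_of_eq_some (i := node (c n)) ?_ ?_ x).trans ih)
      · simp [shift, next_apply hc]
      · intro i hi
        obtain ⟨m, rfl, hm⟩ := shift_eq_node hi
        have := hc hm
        simp_all
  have hpair : ∀ n t, x (pair t (c n)) = 0 := by
    intro n t
    induction n with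
    | zero =>
      refine hfree _ fun i hi => ?_
      obtain ⟨n, -, hn, -⟩ := shift_eq_pair hi
      exact absurd (hc hn) (by simp)
    | succ n ih =>
      by_cases ht : R t (c (n + 1))
      · refine hfree _ fun i hi => ?_
        obtain ⟨n, -, -, hn⟩ := shift_eq_pair hi
        exact hn ht
      · refine hz _ ((partialMap_apply_of_eq_some (i := pair t (c n)) ?_ ?_ x).trans ih)
        · simp [shift, next_apply hc, ht]
        · intro i hi
          obtain ⟨m, rfl, hm, -⟩ := shift_eq_pair hi
          have := hc hm
          simp_all
  ext k
  rcases k with s | ⟨t, s⟩ | _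
  · by_cases hs : ∃ n, s = c n
    · obtain ⟨n, rfl⟩ := hs
      exact hnode n
    · refine hfree _ fun i hi => hs ?_
      obtain ⟨n, -, hn⟩ := shift_eq_node hi
      exact ⟨_, hn⟩
  · by_cases hs : ∃ n, s = c n
    · obtain ⟨n, rfl⟩ := hs
      exact hpair n t
    · refine hfree _ fun i hi => hs ?_
      obtain ⟨n, -, hn, -⟩ := shift_eq_pair hi
      exact ⟨_, hn⟩
  · exact hfree _ shift_ne_base

open Classical in
/-- The sum of the coordinates at the nodes on the sequence `c`. -/
noncomputable def chainSum (c : ℕ → S) : (OrderBasis S →₀ ZMod 2) →ₗ[ZMod 2] ZMod 2 :=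
  Finsupp.linearCombination (ZMod 2) fun i => if ∃ n, i = node (c n) then 1 else 0

theorem chainSum_partialMap_shift (hc : Function.Injective c) (x : OrderBasis S →₀ ZMod 2) :
    chainSum c (partialMap (shift R c) x) = chainSum c x := by
  suffices (chainSum c).comp (partialMap (shift R c)) = chainSum c from
    LinearMap.congr_fun this x
  ext i
  simp only [LinearMap.coe_comp, Function.comp_apply, Finsupp.lsingle_apply, partialMap_single]
  by_cases hi : ∃ n, i = node (c n)
  · obtain ⟨n, rfl⟩ := hi
    simp [shift, next_apply hc, chainSum]
  · have h1 : chainSum c (Finsupp.single i 1) = 0 := by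
      simp only [chainSum, Finsupp.linearCombination_single, if_neg hi, smul_zero]
    rw [h1]
    cases h : shift R c i with
    | none => simp
    | some k =>
      have hk : ¬ ∃ n, k = node (c n) := by
        rintro ⟨n, rfl⟩
        obtain ⟨m, rfl, -⟩ := shift_eq_node h
        exact hi ⟨m, rfl⟩
      simp only [chainSum, Option.elim_some, Finsupp.linearCombination_single, if_neg hk, smul_zero]

/-- An infinite ascending chain yields an injective endomorphism that is not surjective. -/
theorem exists_injective_not_surjective (htrans : ∀ r s t, R r s → R s t → R r t)
    (hc : Function.Injective c) (hRc : ∀ n, R (c n) (c (n + 1))) :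
    ∃ g : (OrderBasis S →₀ ZMod 2) →+ (OrderBasis S →₀ ZMod 2), Function.Injective g ∧
      (∀ j x, operator R j (g x) = g (operator R j x)) ∧ ¬ Function.Surjective g := by
  refine ⟨AddMonoidHom.id _ + (partialMap (shift R c)).toAddMonoidHom, ?_, ?_, ?_⟩
  · rw [injective_iff_map_eq_zero]
    exact fun x hx => eq_zero_of_shift hc hx
  · intro j x
    simp [operator_apply, partialMap_partialMap, move_bind_shift htrans hRc]
  · intro hsurj
    obtain ⟨x, hx⟩ := hsurj (Finsupp.single (node (c 0)) 1)
    -- The shift preserves the chain sum, so every vector in the image has chain sum zero in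
    -- characteristic 2, whereas node `c 0` has chain sum one.
    have h1 := congrArg (chainSum c) hx
    simp only [AddMonoidHom.add_apply, AddMonoidHom.id_apply, LinearMap.toAddMonoidHom_coe, map_add,
      chainSum_partialMap_shift hc, CharTwo.add_self_eq_zero] at h1
    simp [chainSum] at h1

end Chain

end OrderBasis

/-! ### Coding countable groups -/

theorem IsCoHopfian.of_mulEquiv {G H : Type*} [Group G] [Group H] (e : G ≃* H)
    (h : IsCoHopfian G) : IsCoHopfian H := by
  intro f hf y
  obtain ⟨x, hx⟩ := h ((e.symm.toMonoidHom.comp f).comp e.toMonoidHom)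
    (e.symm.injective.comp (hf.comp e.injective)) (e.symm y)
  exact ⟨e x, e.symm.injective hx⟩

namespace GpOmega

/-- The group with domain `ℕ` obtained by transporting a group along a bijection. -/
def ofEquiv {G : Type*} [Group G] (e : G ≃ ℕ) : GpOmega :=
  ⟨fun i j => e (e.symm i * e.symm j),
    fun a b c => by simp [mul_assoc],
    e 1, fun a => by simp, fun a => ⟨e (e.symm a)⁻¹, by simp⟩⟩

/-- A group is isomorphic to its transport to `ℕ`. -/
def ofEquivMulEquiv {G : Type*} [Group G] (e : G ≃ ℕ) : G ≃* (ofEquiv e).Carrier where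
  toEquiv := e
  map_mul' a b := by
    change e (a * b) = e (e.symm (e a) * e.symm (e b))
    simp

end GpOmega

theorem nilpotencyClass_eq_of_mulEquiv {G H : Type*} [Group G] [Group H] (e : G ≃* H)
    (hG : Group.IsNilpotent G) : Group.nilpotencyClass H = Group.nilpotencyClass G := by
  have hH := Group.nilpotent_of_mulEquiv e
  exact le_antisymm (Group.nilpotencyClass_le_of_surjective e.toMonoidHom e.surjective)
    (Group.nilpotencyClass_le_of_surjective e.symm.toMonoidHom e.symm.surjective)

theorem isCoanalyticIn_isCoHopfian (n : ℕ) :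
    IsCoanalyticIn {G : NiGp n | IsCoHopfian G.1.Carrier} := by
  have happ : ∀ (a : NiGp n × (ℕ → ℕ) → ℕ), Measurable a →
      Measurable fun x : NiGp n × (ℕ → ℕ) => x.2 (a x) := by
    intro a ha
    have h : Measurable fun q : (ℕ → ℕ) × ℕ => q.1 q.2 :=
      measurable_from_prod_countable_left fun y => measurable_pi_apply y
    exact h.comp (measurable_snd.prodMk ha)
  have hmul : ∀ (a b : NiGp n × (ℕ → ℕ) → ℕ), Measurable a → Measurable b →
      Measurable fun x : NiGp n × (ℕ → ℕ) => x.1.1.1 (a x) (b x) := by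
    intro a b ha hb
    have h : Measurable fun q : NiGp n × ℕ × ℕ => q.1.1.1 q.2.1 q.2.2 :=
      measurable_from_prod_countable_left fun y => (GpOmega.measurable_mul
        (measurable_const (a := y.1)) (measurable_const (a := y.2))).comp measurable_subtype_coe
    exact h.comp (measurable_fst.prodMk (ha.prodMk hb))
  refine ⟨{x | (∀ a b, x.2 (x.1.1.1 a b) = x.1.1.1 (x.2 a) (x.2 b)) ∧
    (∀ a b, x.2 a = x.2 b → a = b) ∧ ∃ k, ∀ a, x.2 a ≠ k}, ?_, ?_⟩
  · have hc : ∀ a : ℕ, Measurable fun _ : NiGp n × (ℕ → ℕ) => a := fun a => measurable_const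
    refine MeasurableSet.inter (GpOmega.measurableSet_forall fun a =>
      GpOmega.measurableSet_forall fun b => measurableSet_eq_fun
        (happ _ (hmul _ _ (hc a) (hc b))) (hmul _ _ (happ _ (hc a)) (happ _ (hc b))))
      (MeasurableSet.inter (GpOmega.measurableSet_forall fun a =>
      GpOmega.measurableSet_forall fun b => ?_) (GpOmega.measurableSet_exists fun k =>
        GpOmega.measurableSet_forall fun a =>
          (measurableSet_eq_fun (happ _ (hc a)) (hc k)).compl))
    exact (measurableSet_eq_fun (happ _ (hc a)) (happ _ (hc b))).imp (MeasurableSet.const _)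
  · ext G
    simp only [Set.mem_compl_iff, Set.mem_ofPred_eq, Set.mem_image, Prod.exists, exists_and_right,
      exists_eq_right]
    constructor
    · intro h
      simp only [IsCoHopfian, not_forall] at h
      obtain ⟨f, hf, hs⟩ := h
      obtain ⟨k, hk⟩ := not_forall.1 hs
      exact ⟨f, fun a b => map_mul f (G.1.elt a) (G.1.elt b), fun a b h => hf h, k,
        fun a h => hk ⟨a, h⟩⟩
    · rintro ⟨f, hmul, hf, k, hk⟩ h
      obtain ⟨a, ha⟩ := h (MonoidHom.mk' (M := G.1.Carrier) (G := G.1.Carrier) f hmul)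
        (fun a b h => hf a b h) k
      exact hk a ha

/-! ### Trees of analytic sets -/

/-- For `A` the image of a continuous `g`, the tree of `y` consists of the `s` such that `y` lies in
the closure of the image of the cylinder of `s`. By continuity these closures along a branch `x`
meet only in `g x`. Since `PiNat.res` lists entries in reverse, extending a sequence is `cons` and
initial segments are suffixes. -/
theorem MeasureTheory.AnalyticSet.exists_tree {Y : Type*} [TopologicalSpace Y] [PolishSpace Y]
    [MeasurableSpace Y] [BorelSpace Y] {A : Set Y} (hA : MeasureTheory.AnalyticSet A) :
    ∃ T : Y → List ℕ → Prop, (∀ s, MeasurableSet {y | T y s}) ∧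
      (∀ y a s, T y (a :: s) → T y s) ∧
      ∀ y, y ∈ A ↔ ∃ x : ℕ → ℕ, ∀ n, T y (PiNat.res x n) := by
  rw [MeasureTheory.AnalyticSet] at hA
  rcases hA with rfl | ⟨g, hg, rfl⟩
  · exact ⟨fun _ _ => False, by simp, by simp, by simp⟩
  refine ⟨fun y s => y ∈ closure (g '' {x | PiNat.res x s.length = s}),
    fun s => isClosed_closure.measurableSet, fun y a s h => ?_, fun y => ?_⟩
  · refine closure_mono (Set.image_mono fun x hx => ?_) h
    simp only [List.length_cons, Set.mem_ofPred_eq, PiNat.res_succ, List.cons.injEq] at hx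
    exact hx.2
  · constructor
    · rintro ⟨x, rfl⟩
      exact ⟨x, fun n => subset_closure ⟨x, by simp [PiNat.res_length], rfl⟩⟩
    · rintro ⟨x, hx⟩
      refine ⟨x, ?_⟩
      by_contra hne
      obtain ⟨u, v, hu, hv, hxu, hyv, huv⟩ := t2_separation hne
      obtain ⟨_, ⟨z, n, rfl⟩, hxz, hzu⟩ := (PiNat.isTopologicalBasis_cylinders
        (fun _ : ℕ => ℕ)).exists_subset_of_mem_open (show x ∈ g ⁻¹' u from hxu)
          (hu.preimage hg)
      obtain ⟨_, hwv, w, hw, rfl⟩ := mem_closure_iff.1 (hx n) v hv hyv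
      refine Set.disjoint_left.1 huv (hzu ?_) hwv
      rw [Set.mem_ofPred_eq, PiNat.res_length] at hw
      rw [← PiNat.mem_cylinder_iff_eq.1 hxz, PiNat.cylinder_eq_res]
      exact hw

/-- The extension order on finite sequences, restricted to a set `T`. -/
def TreeOrder (T : List ℕ → Prop) (t s : List ℕ) : Prop := t = s ∨ (T s ∧ t <:+ s)

namespace TreeOrder

variable {T : List ℕ → Prop}

theorem suffix {t s : List ℕ} (h : TreeOrder T t s) : t <:+ s := by
  rcases h with rfl | h
  · exact List.suffix_rfl
  · exact h.2

theorem refl (s : List ℕ) : TreeOrder T s s := Or.inl rfl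

theorem trans (r s t : List ℕ) (hrs : TreeOrder T r s) (hst : TreeOrder T s t) :
    TreeOrder T r t := by
  rcases hst with rfl | ⟨ht, hst⟩
  · exact hrs
  · exact Or.inr ⟨ht, hrs.suffix.trans hst⟩

theorem antisymm (r s : List ℕ) (hrs : TreeOrder T r s) (hsr : TreeOrder T s r) : r = s :=
  hrs.suffix.eq_of_length_le hsr.suffix.length_le

theorem exists_not (s : List ℕ) : ∃ t, ¬ TreeOrder T t s :=
  ⟨0 :: s, fun h => by simpa using h.suffix.length_le⟩

theorem of_suffix (hT : ∀ a s, T (a :: s) → T s) {t s : List ℕ} (h : t <:+ s) (hs : T s) :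
    T t := by
  obtain ⟨r, rfl⟩ := h
  induction r with
  | nil => exact hs
  | cons a r ih => exact ih (hT a _ hs)

/-- An ascending chain `f` may skip levels, so the branch is assembled from the suffixes `p n` of `f
n` of length exactly `n`. -/
theorem wellFounded (hT : ∀ a s, T (a :: s) → T s) (h : ¬ ∃ x : ℕ → ℕ, ∀ n, T (PiNat.res x n)) :
    WellFounded fun r s => TreeOrder T s r ∧ r ≠ s := by
  rw [wellFounded_iff_isEmpty_descending_chain]
  refine ⟨fun ⟨f, hf⟩ => h ?_⟩
  have hsuf : ∀ n, f n <:+ f (n + 1) := fun n => (hf n).1.suffix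
  have hTf : ∀ n, T (f (n + 1)) := fun n => ((hf n).1.resolve_left (hf n).2.symm).1
  have hlt : ∀ n, (f n).length < (f (n + 1)).length := fun n =>
    lt_of_le_of_ne (hsuf n).length_le fun he => (hf n).2 ((hsuf n).eq_of_length he).symm
  have hlen : ∀ n, n ≤ (f n).length := by
    intro n
    induction n with
    | zero => exact Nat.zero_le _
    | succ n ih => exact lt_of_le_of_lt ih (hlt n)
  let p : ℕ → List ℕ := fun n => (f n).drop ((f n).length - n)
  have hpf : ∀ n, p n <:+ f n := fun n => List.drop_suffix _ _
  have hpl : ∀ n, (p n).length = n := by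
    intro n
    have := hlen n
    simp only [p, List.length_drop]
    omega
  have hp : ∀ n, ∃ a, p (n + 1) = a :: p n := by
    intro n
    obtain ⟨l, hl⟩ := List.suffix_of_suffix_length_le ((hpf n).trans (hsuf n)) (hpf (n + 1))
      (by rw [hpl, hpl]; omega)
    have h1 : l.length = 1 := by
      have := congrArg List.length hl
      rw [List.length_append, hpl, hpl] at this
      omega
    obtain ⟨a, rfl⟩ := List.length_eq_one_iff.1 h1
    exact ⟨a, hl.symm⟩
  choose x hx using hp
  have hres : ∀ n, PiNat.res x n = p n := by
    intro n
    induction n with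
    | zero => exact (List.length_eq_zero_iff.1 (hpl 0)).symm
    | succ n ih => rw [PiNat.res_succ, hx, ih]
  exact ⟨x, fun n => by
    rw [hres]
    exact of_suffix hT ((hpf n).trans (hsuf n)) (hTf n)⟩

theorem res_injective (x : ℕ → ℕ) : Function.Injective (PiNat.res x) := fun m n h => by
  simpa [PiNat.res_length] using congrArg List.length h

theorem res_res_succ {x : ℕ → ℕ} (h : ∀ n, T (PiNat.res x n)) (n : ℕ) :
    TreeOrder T (PiNat.res x n) (PiNat.res x (n + 1)) :=
  Or.inr ⟨h _, List.suffix_cons _ _⟩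

end TreeOrder

/-! ### The reduction -/

namespace OrderBasis

theorem operators_isCoHopfian_treeOrder_iff {T : List ℕ → Prop} (hT : ∀ a s, T (a :: s) → T s) :
    (∀ g : (OrderBasis (List ℕ) →₀ ZMod 2) →+ (OrderBasis (List ℕ) →₀ ZMod 2),
      Function.Injective g →
      (∀ j x, operator (TreeOrder T) j (g x) = g (operator (TreeOrder T) j x)) →
        Function.Surjective g) ↔ ¬ ∃ x : ℕ → ℕ, ∀ n, T (PiNat.res x n) := by
  constructor
  · rintro h ⟨x, hx⟩
    obtain ⟨g, hg, hcomm, hs⟩ := exists_injective_not_surjective (R := TreeOrder T)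
      TreeOrder.trans (TreeOrder.res_injective x) (TreeOrder.res_res_succ hx)
    exact hs (h g hg hcomm)
  · intro h g hg hcomm
    exact surjective_of_wellFounded TreeOrder.refl TreeOrder.trans TreeOrder.antisymm
      (TreeOrder.wellFounded hT h) TreeOrder.exists_not hg hcomm

end OrderBasis

instance ZMod.instCountable (n : ℕ) : Countable (ZMod n) := by
  cases n with
  | zero => exact inferInstanceAs (Countable ℤ)
  | succ n => exact inferInstanceAs (Countable (Fin (n + 1)))

/-- Pairwise distinct odd primes. -/
noncomputable def oddPrime (i : (List ℕ ⊕ List ℕ × List ℕ) × ℕ) : ℕ :=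
  -- The shift by one skips the prime 2, which has index 0.
  Nat.nth Nat.Prime (Encodable.encode i + 1)

theorem oddPrime_prime (i : (List ℕ ⊕ List ℕ × List ℕ) × ℕ) : (oddPrime i).Prime :=
  Nat.prime_nth_prime _

theorem oddPrime_injective : Function.Injective oddPrime := fun i k h => by
  have := Nat.nth_injective Nat.infinite_setOfPred_prime h
  exact Encodable.encode_injective (Nat.succ_injective this)

theorem oddPrime_ne_two (i : (List ℕ ⊕ List ℕ × List ℕ) × ℕ) : oddPrime i ≠ 2 := fun h => by
  rw [← Nat.nth_prime_zero_eq_two] at h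
  exact Nat.succ_ne_zero _ (Nat.nth_injective Nat.infinite_setOfPred_prime h)

/-- The fibre of the extension attached to a tree. -/
abbrev TreeFibre : Type :=
  PrimaryPart oddPrime × (OrderBasis (List ℕ) →₀ ZMod 2)

/-- The group attached to a tree. -/
abbrev TreeGroup (T : List ℕ → Prop) : Type :=
  UnipotentExt (rigidAction oddPrime (OrderBasis.operator (TreeOrder T)))
    (rigidAction_rigidAction _ OrderBasis.operator_operator)

theorem TreeGroup.isCoHopfian_iff {T : List ℕ → Prop} (hT : ∀ a s, T (a :: s) → T s) :
    IsCoHopfian (TreeGroup T) ↔ ¬ ∃ x : ℕ → ℕ, ∀ n, T (PiNat.res x n) :=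
  (UnipotentExt.isCoHopfian_iff oddPrime_prime oddPrime_ne_two two_nsmul_eq_zero_of_zmod_two
    oddPrime_injective).trans (OrderBasis.operators_isCoHopfian_treeOrder_iff hT)

theorem TreeGroup.isNilpotent_and_nilpotencyClass (T : List ℕ → Prop) :
    Group.IsNilpotent (TreeGroup T) ∧ Group.nilpotencyClass (TreeGroup T) = 2 := by
  refine UnipotentExt.isNilpotent_and_nilpotencyClass ?_
  obtain ⟨t, ht⟩ := TreeOrder.exists_not (T := T) []
  refine ⟨.inl t, (0, Finsupp.single (.node []) 1), fun h => ?_⟩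
  have := congrArg Prod.snd h
  simp [rigidAction, OrderBasis.operator_inl_node_of_not ht] at this

/-- A coding of the elements of the groups attached to trees. -/
noncomputable def treeCode : ((List ℕ ⊕ List ℕ × List ℕ) →₀ ℤ) × TreeFibre ≃ ℕ :=
  (nonempty_denumerable (((List ℕ ⊕ List ℕ × List ℕ) →₀ ℤ) × TreeFibre)).some.eqv

/-- The group attached to a tree, with domain `ℕ`. -/
noncomputable def treeGroupOmega (T : List ℕ → Prop) : NiGp 2 :=
  ⟨GpOmega.ofEquiv ((UnipotentExt.equivProd : TreeGroup T ≃ _).trans treeCode), by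
    have e := GpOmega.ofEquivMulEquiv ((UnipotentExt.equivProd : TreeGroup T ≃ _).trans treeCode)
    have h := TreeGroup.isNilpotent_and_nilpotencyClass T
    have := h.1
    exact ⟨Group.nilpotent_of_mulEquiv e, (nilpotencyClass_eq_of_mulEquiv e h.1).trans h.2⟩⟩

theorem isCoHopfian_treeGroupOmega_iff {T : List ℕ → Prop} (hT : ∀ a s, T (a :: s) → T s) :
    IsCoHopfian (treeGroupOmega T).1.Carrier ↔ ¬ ∃ x : ℕ → ℕ, ∀ n, T (PiNat.res x n) := by
  rw [← TreeGroup.isCoHopfian_iff hT]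
  have e := GpOmega.ofEquivMulEquiv ((UnipotentExt.equivProd : TreeGroup T ≃ _).trans treeCode)
  exact ⟨fun h => h.of_mulEquiv e.symm, fun h => h.of_mulEquiv e⟩

/-! ### Borel dependence of the group on the tree. -/

section Measurability

variable {Y : Type*} [MeasurableSpace Y]

theorem measurable_freeAction {J M : Type*} [AddCommGroup M] [Countable M]
    {D : Y → J → (M →+ M)} (hD : ∀ j v, @Measurable Y M _ ⊤ fun y => D y j v) (a : J →₀ ℤ) (v : M) :
    @Measurable Y M _ ⊤ fun y => freeAction (D y) a v := by
  let _ : MeasurableSpace M := ⊤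
  simp only [freeAction_apply]
  refine Finset.measurable_sum _ fun j _ => ?_
  exact (Measurable.of_discrete (f := fun w : M => a j • w)).comp (hD j v)

theorem measurable_partialMap {I : Type*} [Countable I] {φ : Y → I → Option I}
    (hφ : ∀ i, @Measurable Y (Option I) _ ⊤ fun y => φ y i) (x : I →₀ ZMod 2) :
    @Measurable Y (I →₀ ZMod 2) _ ⊤ fun y => partialMap (φ y) x := by
  let _ : MeasurableSpace (I →₀ ZMod 2) := ⊤
  let _ : MeasurableSpace (Option I) := ⊤
  simp only [partialMap, Finsupp.linearCombination_apply, Finsupp.sum]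
  refine Finset.measurable_sum _ fun i _ => ?_
  exact (Measurable.of_discrete (f := fun k : Option I =>
    x i • k.elim 0 fun k => Finsupp.single k (1 : ZMod 2))).comp (hφ i)

theorem measurable_move {S : Type*} {R : Y → S → S → Prop}
    (hR : ∀ t s, MeasurableSet {y | R y t s}) (j : S ⊕ S × S) (i : OrderBasis S) :
    @Measurable Y (Option (OrderBasis S)) _ ⊤ fun y => OrderBasis.move (R y) j i := by
  let _ : MeasurableSpace (Option (OrderBasis S)) := ⊤
  rcases j with t | ⟨t, s⟩ <;> rcases i with r | ⟨t', s'⟩ | _ <;> simp only [OrderBasis.move]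
  case inl.node => exact Measurable.ite (hR t r) measurable_const measurable_const
  case inr.pair =>
    refine Measurable.ite ?_ measurable_const measurable_const
    exact (MeasurableSet.const _).inter ((MeasurableSet.const _).inter (hR t s))
  all_goals exact measurable_const

/-- All the groups share one countable underlying set and one coding; the tree enters an entry of
the multiplication table only through a single value of `freeAction`, a finite sum of Borel terms.
-/
theorem measurable_treeGroupOmega {T : Y → List ℕ → Prop}
    (hT : ∀ s, MeasurableSet {y | T y s}) : Measurable fun y => treeGroupOmega (T y) := by
  refine Measurable.subtype_mk (Measurable.subtype_mk ?_)
  refine measurable_pi_lambda _ fun i => measurable_pi_lambda _ fun j => ?_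
  have hD : ∀ j v, @Measurable Y TreeFibre _ ⊤ fun y =>
      rigidAction oddPrime (OrderBasis.operator (TreeOrder (T y))) j v := by
    rintro j ⟨p, u⟩
    let _ : MeasurableSpace TreeFibre := ⊤
    let _ : MeasurableSpace (OrderBasis (List ℕ) →₀ ZMod 2) := ⊤
    have h := measurable_partialMap (measurable_move
      (R := fun y => TreeOrder (T y)) (fun t s => (MeasurableSet.const _).union
        ((hT s).inter (MeasurableSet.const _))) j) u
    exact (Measurable.of_discrete (f := fun w : OrderBasis (List ℕ) →₀ ZMod 2 =>
      ((primaryShift oddPrime j p, w) : TreeFibre))).comp h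
  let _ : MeasurableSpace TreeFibre := ⊤
  exact (Measurable.of_discrete (f := fun z : TreeFibre =>
    treeCode ((treeCode.symm i).1 + (treeCode.symm j).1,
      (treeCode.symm i).2 + (treeCode.symm j).2 + z))).comp
    (measurable_freeAction hD (treeCode.symm i).1 (treeCode.symm j).2)

end Measurability

theorem theorem1p5 :
    IsCompleteCoanalyticIn.{0, v} {G : NiGp 2 | IsCoHopfian G.1.Carrier} := by
  refine ⟨isCoanalyticIn_isCoHopfian 2, fun Y _ _ B hB => ?_⟩
  -- A compatible Polish topology on `Y` makes the tree representation available.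
  let _ := upgradeStandardBorel Y
  obtain ⟨T, hTm, hT, hTB⟩ := ((isAnalyticIn_iff_analyticSet _).1 hB).exists_tree
  refine ⟨fun y => treeGroupOmega (T y), measurable_treeGroupOmega hTm, ?_⟩
  ext y
  rw [Set.mem_preimage, Set.mem_ofPred_eq, isCoHopfian_treeGroupOmega_iff (hT y), ← hTB,
    Set.mem_compl_iff, not_not]
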